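/- For $p\in(0,1)$ and $x>0$ let $m_p(x)$ be the $p$-quantile of the gamma distribution with shape parameter $x$ and scale parameter $1$, that is, the unique $m_p(x)>0$ with $\int_0^{m_p(x)}e^{-t}t^{x-1}\,dt=p\,\Gamma(x)$, and put $u_p(x)=e^{-\frac{\log p}{x}}\,m_p(x)$. Then $u_p\in C^\infty((0,\infty))$, and for every integer $n\ge 0$ the limit $\lim_{x\to 0^+}u_p^{(n)}(x)$ exists in $\mathbb R$ and does not depend on $p\in(0,1)$. Hence $u_p$, extended to $x=0$ by $u_p(0)=\lim_{x\to0^+}u_p(x)$, belongs to $C^\infty([0,\infty))$. -/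

import Mathlib

open Real Set Filter Topology MeasureTheory ProbabilityTheory
open scoped ContDiff

/-- The `p`-quantile of a probability measure `μ` on the real line:
the infimum of all `y` with `p ≤ μ (-∞, y]`. -/
noncomputable def quantile (μ : Measure ℝ) (p : ℝ) : ℝ :=
  sInf {y : ℝ | p ≤ cdf μ y}

/-- `m_p(x)`, the `p`-quantile of the gamma distribution with shape parameter `x` and
scale parameter `1` (used for `0 < p < 1` and `0 < x`). -/
noncomputable def gammaQuantile (p x : ℝ) : ℝ :=
  quantile (gammaMeasure x 1) p

/-- `u_p(x) = e^{-log p / x} m_p(x)` (used for `0 < p < 1` and `0 < x`). -/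
noncomputable def uFun (p x : ℝ) : ℝ :=
  Real.exp (-(Real.log p / x)) * gammaQuantile p x

theorem gamma_intervalIntegrable {x : ℝ} (hx : 0 < x) {a b : ℝ} (ha : 0 ≤ a) (hb : 0 ≤ b) :
    IntervalIntegrable (fun t : ℝ => Real.exp (-t) * t ^ (x - 1)) volume a b := by
  rw [intervalIntegrable_iff]
  refine (Real.GammaIntegral_convergent hx).mono_set ?_
  intro t ht
  exact lt_of_le_of_lt (le_min ha hb) ht.1

theorem cdf_gammaMeasure_one {x : ℝ} (hx : 0 < x) {y : ℝ} (hy : 0 ≤ y) :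
    cdf (gammaMeasure x 1) y =
      (∫ t in (0 : ℝ)..y, Real.exp (-t) * t ^ (x - 1)) / Real.Gamma x := by
  rw [cdf_gammaMeasure_eq_integral hx one_pos, intervalIntegral.integral_of_le hy]
  have h1 : ∫ t in Iic y, gammaPDFReal x 1 t = ∫ t in Icc 0 y, gammaPDFReal x 1 t := by
    apply setIntegral_eq_of_subset_of_forall_sdiff_eq_zero measurableSet_Iic Icc_subset_Iic_self
    intro t ht
    have : ¬ (0 ≤ t) := fun h => ht.2 ⟨h, ht.1⟩
    simp [gammaPDFReal, this]
  rw [h1, integral_Icc_eq_integral_Ioc, div_eq_inv_mul, ← integral_const_mul]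
  apply setIntegral_congr_fun measurableSet_Ioc
  intro t ht
  simp only [gammaPDFReal, if_pos ht.1.le, one_rpow, one_mul]
  ring

theorem gamma_integral_strictMono {x : ℝ} (hx : 0 < x) {a b : ℝ} (ha : 0 ≤ a) (hab : a < b) :
    ∫ t in (0 : ℝ)..a, Real.exp (-t) * t ^ (x - 1) <
      ∫ t in (0 : ℝ)..b, Real.exp (-t) * t ^ (x - 1) := by
  have hb : 0 ≤ b := ha.trans hab.le
  rw [← intervalIntegral.integral_add_adjacent_intervals
    (gamma_intervalIntegrable hx le_rfl ha) (gamma_intervalIntegrable hx ha hb)]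
  have : 0 < ∫ t in a..b, Real.exp (-t) * t ^ (x - 1) := by
    apply intervalIntegral.intervalIntegral_pos_of_pos_on (gamma_intervalIntegrable hx ha hb) _ hab
    intro t ht
    have : 0 < t := ha.trans_lt ht.1
    positivity
  linarith

/-- For `0 < p < 1` and `0 < x`, the number `m_p(x)` is the unique `y ≥ 0` with
`∫_0^y e^{-t} t^{x-1} dt = p Γ(x)`, and it is positive. -/
theorem gammaQuantile_spec {p x : ℝ} (hp0 : 0 < p) (hp1 : p < 1) (hx : 0 < x) :
    0 < gammaQuantile p x ∧ ∀ y : ℝ, 0 ≤ y →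
      (∫ t in (0 : ℝ)..y, Real.exp (-t) * t ^ (x - 1) = p * Real.Gamma x ↔
        y = gammaQuantile p x) := by
  have hG := Real.Gamma_pos_of_pos hx
  have key : ∀ y : ℝ, 0 ≤ y →
      ∫ t in (0 : ℝ)..y, Real.exp (-t) * t ^ (x - 1) = p * Real.Gamma x →
      0 < y ∧ gammaQuantile p x = y := by
    intro y hy h
    have hy0 : 0 < y := by
      rcases hy.eq_or_lt with h0 | h0
      · subst h0
        have := mul_pos hp0 hG
        simp at h
        rcases h with h | h <;> linarith
      · exact h0
    have hc : cdf (gammaMeasure x 1) y = p := by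
      rw [cdf_gammaMeasure_one hx hy, h, mul_div_cancel_right₀ _ hG.ne']
    refine ⟨hy0, ?_⟩
    have hS : {z : ℝ | p ≤ cdf (gammaMeasure x 1) z} = Ici y := by
      ext z
      simp only [Set.mem_ofPred_eq, mem_Ici]
      constructor
      · intro hz
        by_contra! hlt
        have h1 : cdf (gammaMeasure x 1) (max z 0) < p := by
          rw [cdf_gammaMeasure_one hx (le_max_right _ _), div_lt_iff₀ hG, ← h]
          exact gamma_integral_strictMono hx (le_max_right _ _) (max_lt hlt hy0)
        have h2 := monotone_cdf (gammaMeasure x 1) (le_max_left z 0)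
        linarith
      · intro hz
        rw [← hc]
        exact monotone_cdf _ hz
    rw [gammaQuantile, quantile, hS, csInf_Ici]
  obtain ⟨b, hb, hb0⟩ : ∃ b, p < cdf (gammaMeasure x 1) b ∧ 0 ≤ b :=
    (((tendsto_cdf_atTop (gammaMeasure x 1)).eventually (lt_mem_nhds hp1)).and
      (eventually_ge_atTop 0)).exists
  rw [cdf_gammaMeasure_one hx hb0, lt_div_iff₀ hG] at hb
  have hcont : ContinuousOn (fun y => ∫ t in (0 : ℝ)..y, Real.exp (-t) * t ^ (x - 1))
      (Icc 0 b) := by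
    have := intervalIntegral.continuousOn_primitive_interval
      (f := fun t : ℝ => Real.exp (-t) * t ^ (x - 1)) (μ := volume) (a := 0) (b := b)
      ((intervalIntegrable_iff' enorm_ne_top).1 (gamma_intervalIntegrable hx le_rfl hb0))
    rwa [uIcc_of_le hb0] at this
  obtain ⟨y, hy, hy'⟩ := intermediate_value_Icc hb0 hcont
    (show p * Real.Gamma x ∈ Icc _ _ from ⟨by simpa using (mul_pos hp0 hG).le, hb.le⟩)
  obtain ⟨h0, h1⟩ := key y hy.1 hy'
  refine ⟨h1 ▸ h0, fun z hz => ⟨fun h => (key z hz h).2.symm, ?_⟩⟩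
  rintro rfl
  rw [h1]
  exact hy'

/-! Integrating e^{-t} = 1 - t g(t), with g(t) = (1 - e^{-t})/t, turns the quantile equation into
m^x (1 - x m G(x, m)) = p Γ(1 + x), where G is smooth for x > -1 (`mul_integral_exp_neg_mul_rpow`).
Put m = p^{1/x} e^w, so that w = log u_p. Taking logarithms and dividing by x gives w + log(1 - x m
G)/x = log Γ(1 + x)/x, and both quotients extend smoothly across x = 0. Now p enters only through
p^{1/x}, which is flat at 0 and extends smoothly by 0 to x ≤ 0. The extended equation has
w-derivative 1 at x = 0, so it has a smooth solution ψ on a two-sided neighbourhood of 0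
(`exists_uFun_eq_exp`). For x ≤ 0 it reads w = log Γ(1 + x)/x, without p. Derivatives of ψ at 0 can
be computed from the left, so they do not depend on p, and u_p = e^ψ on the right. -/

/-! ### Implicit functions, analyticity of Γ and of difference quotients -/

/-- The smooth implicit function theorem for a scalar equation in two real variables. -/
theorem exists_contDiffAt_implicit {F : ℝ × ℝ → ℝ} {a b c : ℝ} (hF : ContDiffAt ℝ ∞ F (a, b))
    (hc : c ≠ 0) (hd : HasDerivAt (fun w => F (a, w)) c b) :
    ∃ ψ : ℝ → ℝ, ContDiffAt ℝ ∞ ψ a ∧ ψ a = b ∧ ∀ᶠ x in 𝓝 a, F (x, ψ x) = F (a, b) := by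
  have hF' : HasFDerivAt F (fderiv ℝ F (a, b)) (a, b) :=
    (hF.differentiableAt (by simp)).hasFDerivAt
  have hinr : HasFDerivAt (fun w : ℝ => (a, w)) (ContinuousLinearMap.inr ℝ ℝ ℝ) b :=
    hasFDerivAt_prodMk_right a b
  have h1 : HasFDerivAt (fun w => F (a, w))
      (fderiv ℝ F (a, b) ∘L ContinuousLinearMap.inr ℝ ℝ ℝ) b :=
    HasFDerivAt.comp (f := fun w : ℝ => (a, w)) b hF' hinr
  have h2 := h1.unique hd.hasFDerivAt
  have hinv : (fderiv ℝ F (a, b) ∘L ContinuousLinearMap.inr ℝ ℝ ℝ).IsInvertible := by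
    refine ⟨ContinuousLinearEquiv.unitsEquivAut ℝ (Units.mk0 c hc), ?_⟩
    rw [h2]
    ext
    simp
  have hn : (∞ : WithTop ℕ∞) ≠ 0 := by simp
  exact ⟨hF.implicitFunction hn hinv, hF.contDiffAt_implicitFunction hn hinv,
    hF.implicitFunction_apply_self hn hinv, hF.eventually_apply_implicitFunction hn hinv⟩

theorem analyticAt_Gamma_of_pos {x : ℝ} (hx : 0 < x) : AnalyticAt ℝ Real.Gamma x := by
  have hopen : IsOpen {z : ℂ | 0 < z.re} := isOpen_lt continuous_const Complex.continuous_re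
  have h : AnalyticAt ℂ Complex.Gamma (x : ℂ) := by
    refine DifferentiableOn.analyticAt (s := {z : ℂ | 0 < z.re}) ?_ (hopen.mem_nhds (by simpa))
    intro z hz
    refine (Complex.differentiableAt_Gamma z fun m hm => ?_).differentiableWithinAt
    have hz' : 0 < z.re := hz
    rw [hm] at hz'
    simp at hz'
    linarith [Nat.cast_nonneg (α := ℝ) m]
  have h2 : AnalyticAt ℝ (fun s : ℝ => Complex.Gamma (s : ℂ)) x :=
    AnalyticAt.comp (f := fun s : ℝ => (s : ℂ)) (h.restrictScalars (𝕜 := ℝ))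
      (Complex.ofRealCLM.analyticAt x)
  exact (Complex.reCLM.analyticAt _).comp h2

theorem AnalyticAt.dslope_self {f : ℝ → ℝ} {a : ℝ} (hf : AnalyticAt ℝ f a) :
    AnalyticAt ℝ (dslope f a) a := by
  obtain ⟨p, hp⟩ := hf
  exact ⟨_, hp.has_fpower_series_dslope_fslope⟩

/-! ### Smooth dependence of the integrals on (x, v) for x > -1 -/

/-- The integral `∫_0^1 φ(v s) s^x (log s)^j ds` as a function of the pair `(x, v)`. -/
noncomputable def rpowLogIntegral (φ : ℝ → ℝ) (j : ℕ) (z : ℝ × ℝ) : ℝ :=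
  ∫ s in Ioc (0 : ℝ) 1, φ (z.2 * s) * s ^ z.1 * log s ^ j

theorem integrableOn_rpow_mul_abs_log_pow {a : ℝ} (ha : -1 < a) (j : ℕ) :
    IntegrableOn (fun s : ℝ => s ^ a * |log s| ^ j) (Ioc 0 1) := by
  -- Each |log s| costs at most s^{-δ}/δ; this δ keeps a - δj above -1, and j + 1 in the denominator
  -- covers j = 0.
  set δ : ℝ := (a + 1) / (2 * (j + 1)) with hδ
  have hδ0 : 0 < δ := by have : 0 < a + 1 := by linarith
                         positivity
  have hexp : -1 < a - δ * j := by
    have : δ * (j + 1) = (a + 1) / 2 := by rw [hδ]; field_simp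
    nlinarith
  have hint : IntegrableOn (fun s : ℝ => (1 / δ) ^ j * s ^ (a - δ * j)) (Ioc 0 1) :=
    ((intervalIntegrable_iff_integrableOn_Ioc_of_le zero_le_one).1
      (intervalIntegral.intervalIntegrable_rpow' hexp)).const_mul _
  refine hint.mono' ?_ ?_
  · refine ContinuousOn.aestronglyMeasurable ?_ measurableSet_Ioc
    exact (continuousOn_id.rpow_const fun s hs => Or.inl hs.1.ne').mul
      ((continuousOn_log.mono fun s hs => hs.1.ne').abs.pow j)
  · refine (ae_restrict_iff' measurableSet_Ioc).2 (Eventually.of_forall fun s hs => ?_)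
    have hs0 := hs.1
    have hb := (abs_log_mul_self_rpow_lt s δ hs.1 hs.2 hδ0).le
    rw [abs_mul, abs_of_pos (rpow_pos_of_pos hs.1 δ)] at hb
    have hsplit : s ^ a = s ^ (a - δ * j) * (s ^ δ) ^ j := by
      rw [← rpow_natCast, ← rpow_mul hs.1.le, ← rpow_add hs.1]
      ring_nf
    rw [norm_of_nonneg (by positivity), hsplit, mul_assoc, ← mul_pow, mul_comm (s ^ δ),
      mul_comm]
    gcongr

theorem continuousOn_rpowLog_integrand {φ : ℝ → ℝ} (hφ : Continuous φ) (j : ℕ) (x v : ℝ) :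
    ContinuousOn (fun s : ℝ => φ (v * s) * s ^ x * log s ^ j) (Ioc 0 1) :=
  ((hφ.comp (continuous_const.mul continuous_id)).continuousOn.mul
    (continuousOn_id.rpow_const fun _ hs => Or.inl hs.1.ne')).mul
      ((continuousOn_log.mono fun _ hs => hs.1.ne').pow j)

theorem abs_mul_le_of_mem_Ioc {v R s : ℝ} (hv : |v| ≤ R) (hs : s ∈ Ioc (0 : ℝ) 1) :
    |v * s| ≤ R := by
  rw [abs_mul, abs_of_pos hs.1]
  nlinarith [abs_nonneg v, hs.1, hs.2]

theorem abs_rpowLog_integrand_le {φ : ℝ → ℝ} {j : ℕ} {x a v R C s : ℝ}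
    (hC : ∀ y ∈ Icc (-R) R, ‖φ y‖ ≤ C) (hv : |v| ≤ R) (hax : a ≤ x) (hs : s ∈ Ioc (0 : ℝ) 1) :
    |φ (v * s) * s ^ x * log s ^ j| ≤ C * (s ^ a * |log s| ^ j) := by
  have h1 := hC _ (abs_le.1 (abs_mul_le_of_mem_Ioc hv hs))
  rw [Real.norm_eq_abs] at h1
  have h2 : s ^ x ≤ s ^ a := rpow_le_rpow_of_exponent_ge hs.1 hs.2 hax
  have h3 : 0 < s ^ x := rpow_pos_of_pos hs.1 x
  rw [abs_mul, abs_mul, abs_pow, abs_of_pos h3, mul_assoc]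
  gcongr
  exact (abs_nonneg _).trans h1

theorem integrableOn_rpowLog_integrand {φ : ℝ → ℝ} (hφ : Continuous φ) (j : ℕ) {x : ℝ}
    (hx : -1 < x) (v : ℝ) :
    IntegrableOn (fun s : ℝ => φ (v * s) * s ^ x * log s ^ j) (Ioc 0 1) := by
  obtain ⟨C, hC⟩ := (isCompact_Icc (a := -|v|) (b := |v|)).exists_bound_of_continuousOn
    hφ.continuousOn
  refine ((integrableOn_rpow_mul_abs_log_pow hx j).const_mul C).mono'
    ((continuousOn_rpowLog_integrand hφ j x v).aestronglyMeasurable measurableSet_Ioc) ?_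
  exact (ae_restrict_iff' measurableSet_Ioc).2 (Eventually.of_forall fun s hs =>
    abs_rpowLog_integrand_le hC le_rfl le_rfl hs)

/-- The family is closed under differentiation: ∂/∂x brings down one more log s, while ∂/∂v replaces
φ by φ' and brings down a factor s, which shifts x by 1. -/
theorem hasFDerivAt_rpowLogIntegral {φ : ℝ → ℝ} (hφ : ContDiff ℝ 1 φ) (j : ℕ) {z₀ : ℝ × ℝ}
    (hz₀ : -1 < z₀.1) :
    HasFDerivAt (rpowLogIntegral φ j)
      (rpowLogIntegral φ (j + 1) z₀ • ContinuousLinearMap.fst ℝ ℝ ℝ +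
        rpowLogIntegral (deriv φ) j (z₀.1 + 1, z₀.2) • ContinuousLinearMap.snd ℝ ℝ ℝ) z₀ := by
  have hφ' : Continuous (deriv φ) := hφ.continuous_deriv le_rfl
  -- On the ball of radius ε the exponent stays above a, the midpoint of -1 and its central value,
  -- so s^a times a power of |log s| dominates.
  set ε : ℝ := (z₀.1 + 1) / 2 with hε
  have hε0 : 0 < ε := by rw [hε]; linarith
  set a : ℝ := (z₀.1 - 1) / 2 with ha
  have ha1 : -1 < a := by rw [ha]; linarith
  set R : ℝ := |z₀.2| + ε with hR
  obtain ⟨C, hC⟩ := (isCompact_Icc (a := -R) (b := R)).exists_bound_of_continuousOn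
    hφ.continuous.continuousOn
  obtain ⟨C', hC'⟩ := (isCompact_Icc (a := -R) (b := R)).exists_bound_of_continuousOn
    hφ'.continuousOn
  have hball : ∀ z ∈ Metric.ball z₀ ε, a ≤ z.1 ∧ |z.2| ≤ R := by
    intro z hz
    rw [Metric.mem_ball, Prod.dist_eq, max_lt_iff, Real.dist_eq, Real.dist_eq] at hz
    constructor
    · have := (abs_lt.1 hz.1).1
      rw [ha]; rw [hε] at this; linarith
    · have := abs_sub_abs_le_abs_sub z.2 z₀.2
      rw [hR]; linarith [hz.2]
  let F' : ℝ × ℝ → ℝ → (ℝ × ℝ →L[ℝ] ℝ) := fun z s =>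
    (φ (z.2 * s) * s ^ z.1 * log s ^ (j + 1)) • ContinuousLinearMap.fst ℝ ℝ ℝ +
      (deriv φ (z.2 * s) * s ^ (z.1 + 1) * log s ^ j) • ContinuousLinearMap.snd ℝ ℝ ℝ
  have hi1 := integrableOn_rpowLog_integrand hφ.continuous (j + 1) hz₀ z₀.2
  have hi2 := integrableOn_rpowLog_integrand hφ' j (x := z₀.1 + 1) (by linarith) z₀.2
  have hI1 : Integrable (fun s => (φ (z₀.2 * s) * s ^ z₀.1 * log s ^ (j + 1)) •
      ContinuousLinearMap.fst ℝ ℝ ℝ) (volume.restrict (Ioc 0 1)) := hi1.smul_const _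
  have hI2 : Integrable (fun s => (deriv φ (z₀.2 * s) * s ^ (z₀.1 + 1) * log s ^ j) •
      ContinuousLinearMap.snd ℝ ℝ ℝ) (volume.restrict (Ioc 0 1)) := hi2.smul_const _
  have key := hasFDerivAt_integral_of_dominated_of_fderiv_le (𝕜 := ℝ)
    (μ := volume.restrict (Ioc (0 : ℝ) 1))
    (F := fun z s => φ (z.2 * s) * s ^ z.1 * log s ^ j) (F' := F') (x₀ := z₀)
    (bound := fun s => C * (s ^ a * |log s| ^ (j + 1)) + C' * (s ^ a * |log s| ^ j))
    (Metric.ball_mem_nhds z₀ hε0)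
    (Eventually.of_forall fun z => (continuousOn_rpowLog_integrand hφ.continuous j
      z.1 z.2).aestronglyMeasurable measurableSet_Ioc)
    (integrableOn_rpowLog_integrand hφ.continuous j hz₀ z₀.2)
    (hI1.aestronglyMeasurable.add hI2.aestronglyMeasurable) ?_
    (((integrableOn_rpow_mul_abs_log_pow ha1 (j + 1)).const_mul C).add
      ((integrableOn_rpow_mul_abs_log_pow ha1 j).const_mul C')) ?_
  · refine HasFDerivAt.congr_fderiv (f := rpowLogIntegral φ j) key ?_
    simp only [F']
    rw [integral_add hI1 hI2, integral_smul_const, integral_smul_const]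
    rfl
  · refine (ae_restrict_iff' measurableSet_Ioc).2 (Eventually.of_forall fun s hs z hz => ?_)
    obtain ⟨hz1, hz2⟩ := hball z hz
    refine (norm_add_le _ _).trans (add_le_add ?_ ?_)
    · rw [norm_smul]
      refine (mul_le_of_le_one_right (norm_nonneg _)
        (ContinuousLinearMap.norm_fst_le ℝ ℝ ℝ)).trans ?_
      exact abs_rpowLog_integrand_le hC hz2 hz1 hs
    · rw [norm_smul]
      refine (mul_le_of_le_one_right (norm_nonneg _)
        (ContinuousLinearMap.norm_snd_le ℝ ℝ ℝ)).trans ?_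
      exact abs_rpowLog_integrand_le hC' hz2 (by linarith) hs
  · refine (ae_restrict_iff' measurableSet_Ioc).2 (Eventually.of_forall fun s hs z hz => ?_)
    have h1 : HasFDerivAt (fun z : ℝ × ℝ => z.2 * s) (s • ContinuousLinearMap.snd ℝ ℝ ℝ) z :=
      (hasFDerivAt_snd (𝕜 := ℝ) (p := z)).mul_const s
    have h2 : HasFDerivAt (fun z : ℝ × ℝ => φ (z.2 * s))
        (deriv φ (z.2 * s) • s • ContinuousLinearMap.snd ℝ ℝ ℝ) z :=
      ((hφ.differentiable (by simp)) (z.2 * s)).hasDerivAt.comp_hasFDerivAt z h1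
    have h3 : HasFDerivAt (fun z : ℝ × ℝ => s ^ z.1)
        ((s ^ z.1 * log s) • ContinuousLinearMap.fst ℝ ℝ ℝ) z := by
      have := (hasStrictDerivAt_const_rpow hs.1 z.1).hasDerivAt
      exact this.comp_hasFDerivAt z hasFDerivAt_fst
    refine ((h2.mul h3).mul_const (log s ^ j)).congr_fderiv ?_
    simp only [F']
    rw [rpow_add_one hs.1.ne']
    ext <;> simp <;> ring

theorem isOpen_neg_one_lt_fst : IsOpen {z : ℝ × ℝ | -1 < z.1} :=
  isOpen_lt continuous_const continuous_fst

/-- Induction with φ and j free, since both partial derivatives lie in the same family. -/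
theorem contDiffOn_rpowLogIntegral_nat (n : ℕ) {φ : ℝ → ℝ} (hφ : ContDiff ℝ ∞ φ) (j : ℕ) :
    ContDiffOn ℝ n (rpowLogIntegral φ j) {z : ℝ × ℝ | -1 < z.1} := by
  induction n generalizing φ j with
  | zero =>
    refine contDiffOn_zero.2 fun z hz => ?_
    exact (hasFDerivAt_rpowLogIntegral (hφ.of_le (by simp)) j hz).continuousAt.continuousWithinAt
  | succ n ih =>
    rw [Nat.cast_add, Nat.cast_one, contDiffOn_succ_iff_hasFDerivWithinAt_of_uniqueDiffOn
      isOpen_neg_one_lt_fst.uniqueDiffOn]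
    refine ⟨by simp, _, ?_, fun z hz =>
      (hasFDerivAt_rpowLogIntegral (hφ.of_le (by simp)) j hz).hasFDerivWithinAt⟩
    have hφ' : ContDiff ℝ ∞ (deriv φ) := (contDiff_infty_iff_deriv.1 hφ).2
    have hcomp : ContDiffOn ℝ n (fun z : ℝ × ℝ => rpowLogIntegral (deriv φ) j (z.1 + 1, z.2))
        {z : ℝ × ℝ | -1 < z.1} := by
      refine (ih hφ' j).comp (f := fun z : ℝ × ℝ => (z.1 + 1, z.2))
        (ContDiff.contDiffOn (by fun_prop)) fun z hz => ?_
      simp only [Set.mem_ofPred_eq] at hz ⊢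
      linarith
    exact ((ih hφ (j + 1)).smul contDiffOn_const).add (hcomp.smul contDiffOn_const)

theorem contDiffAt_rpowLogIntegral {φ : ℝ → ℝ} (hφ : ContDiff ℝ ∞ φ) (j : ℕ) {z : ℝ × ℝ}
    (hz : -1 < z.1) : ContDiffAt ℝ ∞ (rpowLogIntegral φ j) z :=
  (contDiffOn_infty.2 fun n => contDiffOn_rpowLogIntegral_nat n hφ j).contDiffAt
    (isOpen_neg_one_lt_fst.mem_nhds hz)

/-! ### The incomplete gamma integral with its pole at x = 0 removed -/

/-- The entire function `y ↦ (1 - e^{-y}) / y`, as the integral `∫_0^1 e^{-y s} ds`. -/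
noncomputable def oneSubExpNegDiv (y : ℝ) : ℝ :=
  rpowLogIntegral (fun t => exp (-t)) 0 (0, y)

theorem contDiff_oneSubExpNegDiv : ContDiff ℝ ∞ oneSubExpNegDiv := by
  rw [contDiff_iff_contDiffAt]
  intro y
  have h : ContDiff ℝ ∞ (fun t : ℝ => exp (-t)) := by fun_prop
  exact (contDiffAt_rpowLogIntegral h 0 (z := (0, y)) (by simp)).comp (f := fun y : ℝ => (0, y)) y
    (by fun_prop)

theorem mul_oneSubExpNegDiv (y : ℝ) : y * oneSubExpNegDiv y = 1 - exp (-y) := by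
  have h : ∫ s in (0 : ℝ)..1, y * exp (-(y * s)) = -exp (-(y * 1)) - -exp (-(y * 0)) := by
    refine intervalIntegral.integral_eq_sub_of_hasDerivAt (f := fun s => -exp (-(y * s)))
      (fun s _ => ?_) (Continuous.intervalIntegrable (by fun_prop) _ _)
    have h1 : HasDerivAt (fun s => -(y * s)) (-(y * 1)) s := ((hasDerivAt_id s).const_mul y).neg
    exact h1.exp.neg.congr_deriv (by ring)
  rw [intervalIntegral.integral_const_mul, intervalIntegral.integral_of_le zero_le_one] at h
  simp only [oneSubExpNegDiv, rpowLogIntegral, rpow_zero, pow_zero, mul_one]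
  rw [h]
  simp
  ring

/-- The function `G` with `x ∫_0^m e^{-t} t^{x-1} dt = m^x (1 - x m G(x, m))`; it is smooth
up to and beyond `x = 0`. -/
noncomputable def gammaRemainder (z : ℝ × ℝ) : ℝ :=
  rpowLogIntegral oneSubExpNegDiv 0 z

theorem contDiffAt_gammaRemainder {z : ℝ × ℝ} (hz : -1 < z.1) :
    ContDiffAt ℝ ∞ gammaRemainder z :=
  contDiffAt_rpowLogIntegral contDiff_oneSubExpNegDiv 0 hz

/-- Substitute t = m s and compare e^{-ms} with 1. The main term ∫ s^{x-1} = 1/x carries the whole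
pole; the difference gains a factor s, which is why G has exponent x and stays smooth at x = 0. -/
theorem mul_integral_exp_neg_mul_rpow {x m : ℝ} (hx : 0 < x) (hm : 0 < m) :
    x * ∫ t in (0 : ℝ)..m, exp (-t) * t ^ (x - 1) = m ^ x * (1 - x * m * gammaRemainder (x, m)) := by
  have hscale : ∫ t in (0 : ℝ)..m, exp (-t) * t ^ (x - 1) =
      m ^ x * ∫ s in (0 : ℝ)..1, exp (-(m * s)) * s ^ (x - 1) := by
    have h := intervalIntegral.smul_integral_comp_mul_left (a := 0) (b := 1)
      (fun t : ℝ => exp (-t) * t ^ (x - 1)) m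
    rw [mul_zero, mul_one] at h
    rw [← h, smul_eq_mul, ← intervalIntegral.integral_const_mul,
      ← intervalIntegral.integral_const_mul]
    refine intervalIntegral.integral_congr fun s hs => ?_
    rw [uIcc_of_le zero_le_one] at hs
    rw [mul_rpow hm.le hs.1, rpow_sub_one hm.ne']
    field_simp
  have hi1 : IntervalIntegrable (fun s : ℝ => s ^ (x - 1)) volume 0 1 :=
    intervalIntegral.intervalIntegrable_rpow' (by linarith)
  have hi2 : IntervalIntegrable (fun s : ℝ => exp (-(m * s)) * s ^ (x - 1)) volume 0 1 :=
    hi1.continuousOn_mul (by fun_prop)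
  have hG : m * gammaRemainder (x, m) =
      ∫ s in (0 : ℝ)..1, (s ^ (x - 1) - exp (-(m * s)) * s ^ (x - 1)) := by
    rw [gammaRemainder, rpowLogIntegral, ← integral_const_mul,
      intervalIntegral.integral_of_le zero_le_one]
    refine setIntegral_congr_fun measurableSet_Ioc fun s hs => ?_
    have h := mul_oneSubExpNegDiv (m * s)
    have hpow : s ^ x = s * s ^ (x - 1) := by
      rw [rpow_sub_one hs.1.ne']
      field_simp [hs.1.ne']
    simp only [pow_zero, mul_one]
    rw [hpow]
    linear_combination s ^ (x - 1) * h
  rw [intervalIntegral.integral_sub hi1 hi2, integral_rpow (Or.inl (by linarith))] at hG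
  rw [hscale, mul_assoc x m, hG]
  simp [zero_rpow hx.ne']
  field_simp
  ring

theorem eq_gammaQuantile_of_rpow_mul_eq {p x m : ℝ} (hp0 : 0 < p) (hp1 : p < 1) (hx : 0 < x)
    (hm : 0 < m) (h : m ^ x * (1 - x * m * gammaRemainder (x, m)) = p * Real.Gamma (x + 1)) :
    m = gammaQuantile p x := by
  refine ((gammaQuantile_spec hp0 hp1 hx).2 m hm.le).1 (mul_left_cancel₀ hx.ne' ?_)
  rw [mul_integral_exp_neg_mul_rpow hx hm, h, Gamma_add_one hx.ne']
  ring

/-! ### Smoothness for x > 0 -/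

theorem contDiffAt_gammaQuantile {p x₀ : ℝ} (hp0 : 0 < p) (hp1 : p < 1) (hx₀ : 0 < x₀) :
    ContDiffAt ℝ ∞ (gammaQuantile p) x₀ := by
  obtain ⟨hm₀, hspec⟩ := gammaQuantile_spec hp0 hp1 hx₀
  set m₀ := gammaQuantile p x₀
  let F : ℝ × ℝ → ℝ := fun z =>
    z.2 ^ z.1 * (1 - z.1 * z.2 * gammaRemainder z) - p * Real.Gamma (z.1 + 1)
  have hF : ContDiffAt ℝ ∞ F (x₀, m₀) := by
    have h1 : ContDiffAt ℝ ∞ (fun z : ℝ × ℝ => z.2 ^ z.1) (x₀, m₀) :=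
      contDiffAt_snd.rpow contDiffAt_fst hm₀.ne'
    have h2 : ContDiffAt ℝ ∞ gammaRemainder (x₀, m₀) := contDiffAt_gammaRemainder (by simp; linarith)
    have h3 : ContDiffAt ℝ ∞ (fun z : ℝ × ℝ => Real.Gamma (z.1 + 1)) (x₀, m₀) :=
      ContDiffAt.comp (f := fun z : ℝ × ℝ => z.1 + 1) (x₀, m₀)
        (analyticAt_Gamma_of_pos (by simp; linarith)).contDiffAt (by fun_prop)
    fun_prop
  -- The form with G shows joint smoothness; the original integral gives the m-derivative by the
  -- fundamental theorem of calculus, visibly nonzero.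
  have hF0 : ∀ m, 0 < m → F (x₀, m) =
      x₀ * (∫ t in (0 : ℝ)..m, exp (-t) * t ^ (x₀ - 1)) - p * Real.Gamma (x₀ + 1) := fun m hm => by
    rw [mul_integral_exp_neg_mul_rpow hx₀ hm]
  have hd : HasDerivAt (fun w => F (x₀, w)) (x₀ * (exp (-m₀) * m₀ ^ (x₀ - 1))) m₀ := by
    have hcont : ContinuousAt (fun t : ℝ => exp (-t) * t ^ (x₀ - 1)) m₀ :=
      (by fun_prop : ContinuousAt (fun t : ℝ => exp (-t)) m₀).mul
        (continuousAt_id.rpow_const (Or.inl hm₀.ne'))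
    have hmeas : StronglyMeasurableAtFilter (fun t : ℝ => exp (-t) * t ^ (x₀ - 1)) (𝓝 m₀) :=
      Measurable.stronglyMeasurable (by fun_prop) |>.stronglyMeasurableAtFilter
    have h := intervalIntegral.integral_hasDerivAt_right
      (gamma_intervalIntegrable hx₀ le_rfl hm₀.le) hmeas hcont
    refine ((h.const_mul x₀).sub_const (p * Real.Gamma (x₀ + 1))).congr_of_eventuallyEq ?_
    filter_upwards [lt_mem_nhds hm₀] with m hm using hF0 m hm
  obtain ⟨ψ, hψ, hψ₀, hψF⟩ := exists_contDiffAt_implicit hF (by positivity) hd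
  refine hψ.congr_of_eventuallyEq ?_
  have hpos : ∀ᶠ x in 𝓝 x₀, 0 < ψ x := hψ.continuousAt.eventually (lt_mem_nhds (hψ₀ ▸ hm₀))
  have hzero : F (x₀, m₀) = 0 := by
    rw [hF0 _ hm₀, (hspec m₀ hm₀.le).2 rfl, Gamma_add_one hx₀.ne']
    ring
  filter_upwards [hψF, hpos, lt_mem_nhds hx₀] with x h1 h2 h3
  refine (eq_gammaQuantile_of_rpow_mul_eq hp0 hp1 h3 h2 ?_).symm
  rw [hzero] at h1
  exact sub_eq_zero.1 h1

theorem contDiffAt_uFun {p x₀ : ℝ} (hp0 : 0 < p) (hp1 : p < 1) (hx₀ : 0 < x₀) :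
    ContDiffAt ℝ ∞ (uFun p) x₀ := by
  have h : ContDiffAt ℝ ∞ (fun x => exp (-(Real.log p / x))) x₀ :=
    (contDiffAt_const.div contDiffAt_id hx₀.ne').neg.exp
  exact h.mul (contDiffAt_gammaQuantile hp0 hp1 hx₀)

/-! ### One-sided germs and their derivatives -/

theorem Filter.EventuallyEq.eventually_eventuallyEq_nhds {f g : ℝ → ℝ} {a : ℝ} {s : Set ℝ}
    (hs : IsOpen s) (h : f =ᶠ[𝓝[s] a] g) : ∀ᶠ x in 𝓝[s] a, f =ᶠ[𝓝 x] g := by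
  filter_upwards [eventually_eventually_nhdsWithin.2 h, self_mem_nhdsWithin] with x hx hxs
  rwa [hs.nhdsWithin_eq hxs] at hx

theorem ContDiffAt.continuousAt_iteratedDeriv {f : ℝ → ℝ} {a : ℝ} (hf : ContDiffAt ℝ ∞ f a)
    (n : ℕ) : ContinuousAt (iteratedDeriv n f) a := by
  rw [iteratedDeriv_eq_equiv_comp]
  exact (LinearIsometryEquiv.continuous _).continuousAt.comp
    (hf.continuousAt_iteratedFDeriv (by exact_mod_cast le_top))

theorem tendsto_iteratedDeriv_of_eventuallyEq {f g : ℝ → ℝ} {a : ℝ} {s : Set ℝ} (hs : IsOpen s)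
    (hg : ContDiffAt ℝ ∞ g a) (h : f =ᶠ[𝓝[s] a] g) (n : ℕ) :
    Tendsto (iteratedDeriv n f) (𝓝[s] a) (𝓝 (iteratedDeriv n g a)) := by
  refine ((hg.continuousAt_iteratedDeriv n).tendsto.mono_left nhdsWithin_le_nhds).congr' ?_
  filter_upwards [h.eventually_eventuallyEq_nhds hs] with x hx
  exact (hx.iteratedDeriv_eq n).symm

/-- Two smooth germs that agree on one side of a point have the same derivatives there. -/
theorem iteratedDeriv_eq_of_eventuallyEq_nhdsLT {f g : ℝ → ℝ} {a : ℝ} (hf : ContDiffAt ℝ ∞ f a)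
    (hg : ContDiffAt ℝ ∞ g a) (h : f =ᶠ[𝓝[<] a] g) (n : ℕ) :
    iteratedDeriv n f a = iteratedDeriv n g a :=
  tendsto_nhds_unique
    ((hf.continuousAt_iteratedDeriv n).tendsto.mono_left nhdsWithin_le_nhds)
    (tendsto_iteratedDeriv_of_eventuallyEq isOpen_Iio hg h n)

/-! ### The equation for log u_p across x = 0 -/

/-- The smooth function `x ↦ log Γ(1 + x) / x`, extended by continuity to `x = 0`. -/
noncomputable def logGammaDiv (x : ℝ) : ℝ :=
  dslope (fun y => Real.log (Real.Gamma y)) 1 (1 + x)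

theorem mul_logGammaDiv (x : ℝ) : x * logGammaDiv x = Real.log (Real.Gamma (1 + x)) := by
  have h := sub_smul_dslope (fun y => Real.log (Real.Gamma y)) 1 (1 + x)
  simpa [logGammaDiv] using h

theorem contDiffAt_logGammaDiv : ContDiffAt ℝ ∞ logGammaDiv 0 := by
  have h1 : AnalyticAt ℝ (fun y => Real.log (Real.Gamma y)) 1 :=
    (analyticAt_Gamma_of_pos one_pos).log (by simp)
  exact ContDiffAt.comp (f := fun x : ℝ => 1 + x) 0
    (by simpa using h1.dslope_self.contDiffAt) (by fun_prop)

/-- With y = x P this divides log(1 - x P) by x without a singularity at x = 0. -/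
theorem neg_mul_dslope_log (y : ℝ) : -y * dslope Real.log 1 (1 - y) = Real.log (1 - y) := by
  have h := sub_smul_dslope Real.log 1 (1 - y)
  simpa using h

theorem contDiffAt_dslope_log : ContDiffAt ℝ ∞ (dslope Real.log 1) 1 :=
  (analyticAt_log one_pos).dslope_self.contDiffAt

/-- The flat function equal to `p^{1/x}` for `x > 0` and to `0` for `x ≤ 0`. -/
noncomputable def flatRoot (p x : ℝ) : ℝ :=
  expNegInvGlue (x / -Real.log p)

theorem contDiff_flatRoot (p : ℝ) : ContDiff ℝ ∞ (flatRoot p) :=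
  expNegInvGlue.contDiff.comp (by fun_prop)

theorem flatRoot_of_nonpos {p x : ℝ} (hp0 : 0 < p) (hp1 : p < 1) (hx : x ≤ 0) :
    flatRoot p x = 0 :=
  expNegInvGlue.zero_of_nonpos
    (div_nonpos_of_nonpos_of_nonneg hx (neg_nonneg.2 (log_neg hp0 hp1).le))

theorem flatRoot_of_pos {p x : ℝ} (hp0 : 0 < p) (hp1 : p < 1) (hx : 0 < x) :
    flatRoot p x = exp (Real.log p / x) := by
  have h : ¬ x / -Real.log p ≤ 0 := not_le.2 (div_pos hx (neg_pos.2 (log_neg hp0 hp1)))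
  rw [flatRoot, expNegInvGlue, if_neg h, inv_div, neg_div, neg_neg]

/-- Near `x = 0`, the function `u_p` is the restriction to `x > 0` of the exponential of a smooth
function that does not depend on `p` for `x ≤ 0`. -/
theorem exists_uFun_eq_exp {p : ℝ} (hp0 : 0 < p) (hp1 : p < 1) :
    ∃ ψ : ℝ → ℝ, ContDiffAt ℝ ∞ ψ 0 ∧ (∀ᶠ x in 𝓝[>] 0, uFun p x = exp (ψ x)) ∧
      ∀ᶠ x in 𝓝[≤] 0, ψ x = logGammaDiv x := by
  -- V is the candidate quantile m = p^{1/x} e^w, P is m G(x, m), and F = 0 is the logarithm of the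
  -- quantile equation divided by x.
  let V : ℝ × ℝ → ℝ := fun z => flatRoot p z.1 * exp z.2
  let P : ℝ × ℝ → ℝ := fun z => V z * gammaRemainder (z.1, V z)
  let F : ℝ × ℝ → ℝ := fun z =>
    z.2 - P z * dslope Real.log 1 (1 - z.1 * P z) - logGammaDiv z.1
  set w₀ := logGammaDiv 0
  have hV0 : ∀ x ≤ 0, ∀ w, V (x, w) = 0 := fun x hx w => by
    simp [V, flatRoot_of_nonpos hp0 hp1 hx]
  have hF0 : ∀ x ≤ 0, ∀ w, F (x, w) = w - logGammaDiv x := fun x hx w => by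
    simp [F, P, hV0 x hx w]
  have hV : ContDiffAt ℝ ∞ V (0, w₀) :=
    (((contDiff_flatRoot p).comp contDiff_fst).mul contDiff_snd.exp).contDiffAt
  have hP : ContDiffAt ℝ ∞ P (0, w₀) := by
    refine hV.mul (ContDiffAt.comp (f := fun z : ℝ × ℝ => (z.1, V z)) (0, w₀) ?_
      (contDiffAt_fst.prodMk hV))
    exact contDiffAt_gammaRemainder (by simp)
  have hF : ContDiffAt ℝ ∞ F (0, w₀) := by
    have h1 : ContDiffAt ℝ ∞ (fun z : ℝ × ℝ => dslope Real.log 1 (1 - z.1 * P z)) (0, w₀) :=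
      ContDiffAt.comp (f := fun z : ℝ × ℝ => 1 - z.1 * P z) (0, w₀)
        (by rw [zero_mul, sub_zero]; exact contDiffAt_dslope_log) (contDiffAt_const.sub (contDiffAt_fst.mul hP))
    have h2 : ContDiffAt ℝ ∞ (fun z : ℝ × ℝ => logGammaDiv z.1) (0, w₀) :=
      ContDiffAt.comp (f := Prod.fst) (0, w₀) contDiffAt_logGammaDiv contDiffAt_fst
    exact (contDiffAt_snd.sub (hP.mul h1)).sub h2
  have hd : HasDerivAt (fun w => F (0, w)) 1 w₀ := by
    simp only [hF0 0 le_rfl]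
    exact (hasDerivAt_id w₀).sub_const _
  obtain ⟨ψ, hψ, hψ0, hψF⟩ := exists_contDiffAt_implicit hF one_ne_zero hd
  rw [hF0 0 le_rfl, sub_self] at hψF
  refine ⟨ψ, hψ, ?_, ?_⟩
  · have hcont : ContinuousAt (fun x => 1 - x * P (x, ψ x)) 0 := by
      have : ContinuousAt (fun x => P (x, ψ x)) 0 :=
        ContinuousAt.comp (g := P) (f := fun x => (x, ψ x)) (by rw [hψ0]; exact hP.continuousAt)
          (continuousAt_id.prodMk hψ.continuousAt)
      exact continuousAt_const.sub (continuousAt_id.mul this)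
    -- Positivity is needed to undo the logarithm and return to the quantile equation.
    have hpos : ∀ᶠ x in 𝓝 0, 0 < 1 - x * P (x, ψ x) :=
      hcont.eventually (lt_mem_nhds (by simp))
    filter_upwards [hψF.filter_mono nhdsWithin_le_nhds, hpos.filter_mono nhdsWithin_le_nhds,
      self_mem_nhdsWithin] with x hFx hposx hx
    have hx : 0 < x := hx
    have hq := flatRoot_of_pos hp0 hp1 hx
    have hVpos : 0 < V (x, ψ x) := by simp only [V, hq]; positivity
    have hG : 0 < Real.Gamma (x + 1) := Gamma_pos_of_pos (by linarith)
    have hlog : x * ψ x + Real.log (1 - x * P (x, ψ x)) = Real.log (Real.Gamma (x + 1)) := by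
      rw [← neg_mul_dslope_log, add_comm x 1, ← mul_logGammaDiv]
      simp only [F] at hFx
      linear_combination x * hFx
    -- The x-th power of p^{1/x} restores the factor p of the quantile equation.
    have hpow : V (x, ψ x) ^ x = p * exp (x * ψ x) := by
      simp only [V, hq]
      rw [← exp_add, ← exp_mul, add_mul, div_mul_cancel₀ _ hx.ne', exp_add, exp_log hp0,
        mul_comm x]
    have hm : V (x, ψ x) = gammaQuantile p x := by
      refine eq_gammaQuantile_of_rpow_mul_eq hp0 hp1 hx hVpos ?_
      rw [hpow, mul_assoc x, ← exp_log hG, ← hlog, exp_add, exp_log hposx]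
      ring
    rw [uFun, ← hm]
    simp only [V, hq]
    rw [← mul_assoc, ← exp_add, neg_add_cancel, exp_zero, one_mul]
  · filter_upwards [hψF.filter_mono nhdsWithin_le_nhds, self_mem_nhdsWithin] with x hFx hx
    rw [hF0 x hx] at hFx
    exact sub_eq_zero.1 hFx

/-! ### Limits of the derivatives and smooth extension to x = 0 -/

theorem proposition3 :
    ∃ L : ℕ → ℝ, ∀ p : ℝ, 0 < p → p < 1 →
      (∀ n : ℕ, Tendsto (iteratedDeriv n (uFun p)) (𝓝[>] (0 : ℝ)) (𝓝 (L n))) ∧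
      ContDiffOn ℝ ∞ (uFun p) (Ioi 0) ∧
      ContDiffOn ℝ ∞ (Function.update (uFun p) 0 (L 0)) (Ici 0) := by
  -- The limits are the derivatives at 0 of Γ(1 + x)^{1/x}, which equals e^ψ to the left of 0 for
  -- every p.
  refine ⟨fun n => iteratedDeriv n (fun x => exp (logGammaDiv x)) 0, fun p hp0 hp1 => ?_⟩
  obtain ⟨ψ, hψ, hright, hleft⟩ := exists_uFun_eq_exp hp0 hp1
  have hexp : ContDiffAt ℝ ∞ (fun x => exp (ψ x)) 0 := hψ.exp
  have hlt : (fun x => exp (ψ x)) =ᶠ[𝓝[<] 0] fun x => exp (logGammaDiv x) := by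
    filter_upwards [hleft.filter_mono (nhdsWithin_mono _ Iio_subset_Iic_self)] with x hx
    rw [hx]
  refine ⟨fun n => ?_, fun x hx => (contDiffAt_uFun hp0 hp1 hx).contDiffWithinAt, fun x hx => ?_⟩
  · beta_reduce
    rw [← iteratedDeriv_eq_of_eventuallyEq_nhdsLT hexp contDiffAt_logGammaDiv.exp hlt n]
    exact tendsto_iteratedDeriv_of_eventuallyEq isOpen_Ioi hexp hright n
  · rcases (mem_Ici.1 hx).eq_or_lt with rfl | hx0
    · have h0 : exp (ψ 0) = exp (logGammaDiv 0) := by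
        rw [hleft.self_of_nhdsWithin self_mem_Iic]
      refine hexp.contDiffWithinAt.congr_of_eventuallyEq ?_ (by simp [h0])
      -- Agreement with e^ψ is checked separately at the point 0, where the updated value enters,
      -- and on the open right side.
      rw [← Ioi_insert, nhdsWithin_insert, EventuallyEq, eventually_sup, eventually_pure]
      refine ⟨by simp [h0], ?_⟩
      filter_upwards [hright, self_mem_nhdsWithin] with x hx hx0
      rw [Function.update_of_ne (ne_of_gt hx0), hx]
    · refine ContDiffAt.contDiffWithinAt ?_
      refine (contDiffAt_uFun hp0 hp1 hx0).congr_of_eventuallyEq ?_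
      filter_upwards [lt_mem_nhds hx0] with y hy
      rw [Function.update_of_ne hy.ne']
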